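/- Let $e\ge 0$, $n$, $w$ be integers with $e<w$ and $2w\le n$. Let $A(n,d,w)$ denote the maximum number of codewords in a binary code of length $n$, constant weight $w$ and mutual Hamming distance at least $d$, and let $T(w_1,n_1,w_2,n_2,d)$ denote the maximum number of binary words of length $n_1+n_2$ with mutual Hamming distance at least $d$, each having exactly $w_1$ ones in the first $n_1$ coordinates and exactly $w_2$ ones in the last $n_2$ coordinates. For the Johnson scheme of binary words of length $n$ and weight $w$ (with distance equal to half the Hamming distance) and $0\le i,k\le w$ put $$v_i=\binom wi\binom{n-w}i,\qquad \mu_k=\binom nk-\binom n{k-1},\qquad E_i(k)=\sum_{j=0}^{i}(-1)^j\binom kj\binom{w-k}{i-j}\binom{n-w-k}{i-j},\qquad q_k(i)=\frac{\mu_k\,E_i(k)}{v_i},$$ where $\binom n{-1}=0$. Let $\mathcal U_w(n)=\max\{A_{2e+1}\}$, where the maximum is over all real sequences $A_0,\dots,A_w$ (with $A_i=0$ for $i>w$) satisfying Delsarte's linear constraints $$A_0=1,\qquad A_i=0\ \ (1\le i<2e+1),\qquad A_i\ge 0\ \ (0\le i\le w),\qquad \sum_{i=0}^{w}A_i\,q_k(i)\ge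 0\ \ (0\le k\le w).$$ Then this maximum exists. With $$D=\sum_{i=0}^{e}\binom wi\binom{n-w}i+\frac{\binom w{e+1}\binom{n-w}{e+1}-\binom{2e+1}{e}^2\,\mathcal U_w(n)}{T(e+1,\,w,\,e+1,\,n-w,\,4e+2)}$$ one has $A(n,4e+2,w)\cdot D\le\binom nw$; that is, whenever the denominator $D$ is positive, $$A(n,4e+2,w)\le\frac{\binom nw}{D}.$$ -/

import Mathlib

/-- A set of binary words has mutual Hamming distance at least `d`. -/
def HasMutualDistance {ι : Type} [Fintype ι] (d : ℕ) (C : Finset (ι → ZMod 2)) : Prop :=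
  ∀ x ∈ C, ∀ y ∈ C, x ≠ y → d ≤ hammingDist x y

open Classical in
/-- `A(n, d, w)`: the maximum number of codewords in a binary code of length `n`, constant
weight `w` and mutual Hamming distance at least `d`. -/
noncomputable def constWeightA (n d w : ℕ) : ℕ :=
  (Finset.univ.filter fun C : Finset (Fin n → ZMod 2) =>
    (∀ x ∈ C, hammingNorm x = w) ∧ HasMutualDistance d C).sup Finset.card

open Classical in
/-- `T(w₁, n₁, w₂, n₂, d)`: the maximum number of binary words of length `n₁ + n₂` having mutual
Hamming distance at least `d`, each with exactly `w₁` ones in the first `n₁` coordinates and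
exactly `w₂` ones in the last `n₂` coordinates. -/
noncomputable def doublyConstWeightT (w₁ n₁ w₂ n₂ d : ℕ) : ℕ :=
  (Finset.univ.filter fun C : Finset (Fin n₁ ⊕ Fin n₂ → ZMod 2) =>
    (∀ x ∈ C, hammingNorm (fun i => x (Sum.inl i)) = w₁ ∧
      hammingNorm (fun i => x (Sum.inr i)) = w₂) ∧ HasMutualDistance d C).sup Finset.card

namespace JohnsonScheme

/-- The valency `v_i` of the `i`-th relation (half the Hamming distance equals `i`) of the
Johnson scheme of binary words of length `n` and weight `w`. -/
def valency (n w i : ℕ) : ℕ := w.choose i * (n - w).choose i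

/-- The Eberlein polynomial `E_i(k)`: the eigenvalue of the `i`-th relation of the Johnson scheme
on its `k`-th common eigenspace (used for `k ≤ w ≤ n - w`). -/
def eberlein (n w i k : ℕ) : ℤ :=
  ∑ j ∈ Finset.range (i + 1),
    (-1 : ℤ) ^ j * (k.choose j) * ((w - k).choose (i - j)) * ((n - w - k).choose (i - j))

/-- The multiplicity `μ_k = C(n, k) - C(n, k - 1)`, with `C(n, -1) = 0`: the dimension of the
`k`-th common eigenspace. -/
def eigenspaceDim (n k : ℕ) : ℤ :=
  (n.choose k : ℤ) - if k = 0 then 0 else (n.choose (k - 1) : ℤ)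

/-- The second eigenvalues (dual eigenvalues) `q_k(i) = μ_k E_i(k) / v_i` of the Johnson
scheme. -/
noncomputable def dualEigenvalue (n w k i : ℕ) : ℝ :=
  (eigenspaceDim n k : ℝ) * (eberlein n w i k : ℝ) / (valency n w i : ℝ)

/-- Delsarte's linear constraints for the distance distribution `A_0, …, A_w` of a code with
minimum distance `2e + 1` in the Johnson scheme of words of length `n` and weight `w`
(the sequence is extended by zero beyond `w`). -/
structure DelsarteConstraints (n w e : ℕ) (a : ℕ → ℝ) : Prop where
  zero_eq_one : a 0 = 1
  gap : ∀ i, 1 ≤ i → i < 2 * e + 1 → a i = 0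
  beyond : ∀ i, w < i → a i = 0
  nonneg : ∀ i, 0 ≤ a i
  delsarte : ∀ k ≤ w, 0 ≤ ∑ i ∈ Finset.range (w + 1), a i * dualEigenvalue n w k i

/-- The values taken by `A_{2e+1}` subject to Delsarte's linear constraints. -/
def lpValues (n w e : ℕ) : Set ℝ :=
  {t | ∃ a : ℕ → ℝ, DelsarteConstraints n w e a ∧ a (2 * e + 1) = t}

/-- The denominator of the bound, as a function of the value `U` of the linear program. -/
noncomputable def boundDenominator (n w e : ℕ) (U : ℝ) : ℝ :=
  (∑ i ∈ Finset.range (e + 1), (w.choose i : ℝ) * ((n - w).choose i : ℝ)) +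
    ((w.choose (e + 1) : ℝ) * ((n - w).choose (e + 1) : ℝ) -
        ((2 * e + 1).choose e : ℝ) ^ 2 * U) /
      (doublyConstWeightT (e + 1) w (e + 1) (n - w) (4 * e + 2) : ℝ)

end JohnsonScheme

/-! Identify words with their supports, so that distance is `(X \ Y).card`. In a code `C` with
minimum distance 2e+1, the balls of radius e are disjoint; let r be the number of words outside all
of them. Count pairs (X, Z) with X in `C` and Z at distance e+1 from X (`packing_inequality`). An
uncovered Z lies in at most T such pairs. A covered Z lies in the ball of some Y, which forces d(X,
Y) = 2e+1 and puts Z on a geodesic, with at most C(2e+1, e)^2 choices for each (X, Y). The number of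
pairs (X, Y) is |C| times A_{2e+1} of the distance distribution, hence at most |C| U, because that
distribution is feasible for the linear program.

Up to a positive factor, q_k(i) is the sum `zonal 0 k`. This serves twice. It is the value of a
positive semidefinite kernel on pairs of w-sets, which gives Delsarte's inequalities for codes. Its
recurrence in `t` also bounds every feasible sequence, so the feasible set is compact and the
maximum exists. -/

namespace JohnsonScheme

/-! ### Zonal sums and the dual eigenvalues -/

/-- An alternating sum of products of falling factorials. With `t = 0` and `(a, b, c, d)` the
numbers of coordinates of the four types `(1,1)`, `(1,0)`, `(0,1)`, `(0,0)` of a pair of words,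
it is, up to scaling, the `k`-th zonal kernel of the Johnson scheme. -/
noncomputable def zonal (t k a b c d : ℕ) : ℝ :=
  ∑ j ∈ Finset.range (k + 1), (k.choose j : ℝ) *
    ((-1) ^ j * b.descFactorial j * c.descFactorial j * a.descFactorial (k - j + t) *
      d.descFactorial (k - j))

theorem cast_descFactorial_succ (n k : ℕ) :
    (n.descFactorial (k + 1) : ℝ) = ((n : ℝ) - k) * n.descFactorial k := by
  rw [Nat.descFactorial_succ, Nat.cast_mul]
  rcases le_or_gt k n with h | h
  · rw [Nat.cast_sub h]
  · simp [Nat.descFactorial_of_lt h]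

theorem mul_descFactorial_pred (n k : ℕ) :
    (n : ℝ) * (n - 1).descFactorial k = n.descFactorial (k + 1) := by
  cases n with
  | zero => simp
  | succ n => rw [Nat.succ_descFactorial_succ, Nat.add_sub_cancel, Nat.cast_mul]

/-- Pascal's rule applied to the coefficients C(k+1, j). -/
theorem zonal_succ (t k a b c d : ℕ) :
    zonal t (k + 1) a b c d =
      ∑ j ∈ Finset.range (k + 1), (k.choose j : ℝ) *
        ((-1) ^ j * b.descFactorial j * c.descFactorial j * a.descFactorial (k - j + 1 + t) *
          d.descFactorial (k - j + 1)) -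
      ∑ j ∈ Finset.range (k + 1), (k.choose j : ℝ) *
        ((-1) ^ j * b.descFactorial (j + 1) * c.descFactorial (j + 1) *
          a.descFactorial (k - j + t) * d.descFactorial (k - j)) := by
  have h := Finset.sum_choose_succ_mul (R := ℝ) (fun j l =>
    (-1) ^ j * b.descFactorial j * c.descFactorial j * a.descFactorial (l + t) *
      d.descFactorial l) k
  rw [zonal, h, sub_eq_add_neg, ← Finset.sum_neg_distrib]
  congr 1
  · refine Finset.sum_congr rfl fun j hj => ?_
    have : k + 1 - j = k - j + 1 := by have := Finset.mem_range.1 hj; omega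
    rw [this]
  · refine Finset.sum_congr rfl fun j _ => ?_
    rw [pow_succ]; ring

/-- With A = a-t-(k-j), B = b-j, C = c-j, D = d-(k-j), this is termwise A(A+B+C+D) = AD - BC +
(A+B)(A+C). -/
theorem zonal_shift (t k a b c d : ℕ) :
    ((a : ℝ) + b + c + d - t - 2 * k) * zonal (t + 1) k a b c d =
      zonal t (k + 1) a b c d +
        ((a : ℝ) + b - t - k) * ((a : ℝ) + c - t - k) * zonal t k a b c d := by
  rw [zonal_succ, zonal, zonal, Finset.mul_sum, Finset.mul_sum, ← Finset.sum_sub_distrib,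
    ← Finset.sum_add_distrib]
  refine Finset.sum_congr rfl fun j hj => ?_
  have hjk : j ≤ k := by have := Finset.mem_range.1 hj; omega
  have e1 : k - j + (t + 1) = k - j + t + 1 := by ring
  have e2 : k - j + 1 + t = k - j + t + 1 := by ring
  rw [e1, e2, cast_descFactorial_succ a, cast_descFactorial_succ d, cast_descFactorial_succ b,
    cast_descFactorial_succ c, Nat.cast_add, Nat.cast_sub hjk]
  ring

theorem zonal_zero_succ (k a b c d : ℕ) :
    zonal 0 (k + 1) a b c d =
      (a : ℝ) * d * zonal 0 k (a - 1) b c (d - 1) -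
        (b : ℝ) * c * zonal 0 k a (b - 1) (c - 1) d := by
  rw [zonal_succ, zonal, zonal, Finset.mul_sum, Finset.mul_sum]
  congr 1 <;> refine Finset.sum_congr rfl fun j _ => ?_
  · rw [add_zero, add_zero, ← mul_descFactorial_pred a, ← mul_descFactorial_pred d]; ring
  · rw [← mul_descFactorial_pred b, ← mul_descFactorial_pred c]; ring

theorem choose_mul_descFactorial {w i j k : ℕ} (hi : i ≤ w) (hk : k ≤ w) (hji : j ≤ i)
    (hjk : j ≤ k) :
    (w - k).choose (i - j) * w.descFactorial k =
      w.choose i * i.descFactorial j * (w - i).descFactorial (k - j) := by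
  rcases lt_or_ge (w - k) (i - j) with h | h
  · rw [Nat.choose_eq_zero_of_lt h, (w - i).descFactorial_of_lt (by omega)]; simp
  · have h1 := Nat.choose_mul_factorial_mul_factorial h
    have h2 := Nat.choose_mul_factorial_mul_factorial hi
    have h3 := Nat.factorial_mul_descFactorial hk
    have h4 := Nat.factorial_mul_descFactorial hji
    have h5 := Nat.factorial_mul_descFactorial (show k - j ≤ w - i by omega)
    have e : w - i - (k - j) = w - k - (i - j) := by omega
    rw [e] at h5
    have hpos : 0 < (i - j).factorial * (w - k - (i - j)).factorial := by positivity
    -- After multiplication by this factor both sides become w!.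
    apply Nat.eq_of_mul_eq_mul_right hpos
    calc _ = ((w - k).choose (i - j) * (i - j).factorial * (w - k - (i - j)).factorial) *
              w.descFactorial k := by ring
      _ = w.choose i * i.factorial * (w - i).factorial := by rw [h1, h3, h2]
      _ = _ := by rw [← h4, ← h5]; ring

theorem eberlein_mul_descFactorial {n w i k : ℕ} (hwn : 2 * w ≤ n) (hi : i ≤ w) (hk : k ≤ w) :
    (eberlein n w i k : ℝ) * (w.descFactorial k * (n - w).descFactorial k) =
      valency n w i * zonal 0 k (w - i) i i (n - w - i) := by
  -- The two sums have different ranges; on one side terms with j > k vanish, on the other those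
  -- with j > i, so both are cut at `min i k`.
  have l1 : (eberlein n w i k : ℝ) = ∑ j ∈ Finset.range (min i k + 1),
      (-1 : ℝ) ^ j * (k.choose j) * ((w - k).choose (i - j)) *
        ((n - w - k).choose (i - j)) := by
    rw [eberlein]
    push_cast
    symm
    apply Finset.sum_subset
    · intro j hj; simp only [Finset.mem_range] at *; omega
    · intro j hj hj'
      simp only [Finset.mem_range] at *
      rw [Nat.choose_eq_zero_of_lt (show k < j by omega)]; simp
  have l2 : zonal 0 k (w - i) i i (n - w - i) = ∑ j ∈ Finset.range (min i k + 1),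
      (k.choose j : ℝ) * ((-1) ^ j * i.descFactorial j * i.descFactorial j *
        (w - i).descFactorial (k - j + 0) * (n - w - i).descFactorial (k - j)) := by
    rw [zonal]
    symm
    apply Finset.sum_subset
    · intro j hj; simp only [Finset.mem_range] at *; omega
    · intro j hj hj'
      simp only [Finset.mem_range] at *
      rw [Nat.descFactorial_of_lt (show i < j by omega)]; simp
  rw [l1, l2, Finset.sum_mul, Finset.mul_sum]
  refine Finset.sum_congr rfl fun j hj => ?_
  have hj := Finset.mem_range.1 hj
  have c1 := choose_mul_descFactorial hi hk (show j ≤ i by omega) (show j ≤ k by omega)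
  have c2 := choose_mul_descFactorial (show i ≤ n - w by omega) (show k ≤ n - w by omega)
    (show j ≤ i by omega) (show j ≤ k by omega)
  have c1' : ((w - k).choose (i - j) : ℝ) * w.descFactorial k =
      w.choose i * i.descFactorial j * (w - i).descFactorial (k - j) := by exact_mod_cast c1
  have c2' : ((n - w - k).choose (i - j) : ℝ) * (n - w).descFactorial k =
      (n - w).choose i * i.descFactorial j * (n - w - i).descFactorial (k - j) := by
    exact_mod_cast c2
  rw [valency, Nat.cast_mul, add_zero]
  linear_combination (-1 : ℝ) ^ j * (k.choose j) * ((n - w - k).choose (i - j) *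
    (n - w).descFactorial k) * c1' + (-1 : ℝ) ^ j * (k.choose j) * (w.choose i *
    i.descFactorial j * (w - i).descFactorial (k - j)) * c2'

theorem dualEigenvalue_eq {n w i k : ℕ} (hwn : 2 * w ≤ n) (hi : i ≤ w) (hk : k ≤ w) :
    dualEigenvalue n w k i =
      (eigenspaceDim n k : ℝ) / (w.descFactorial k * (n - w).descFactorial k) *
        zonal 0 k (w - i) i i (n - w - i) := by
  have h := eberlein_mul_descFactorial hwn hi hk
  have hv : (valency n w i : ℝ) ≠ 0 := by
    rw [valency, Nat.cast_ne_zero]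
    exact (Nat.mul_pos (Nat.choose_pos hi) (Nat.choose_pos (by omega))).ne'
  have h1 : (w.descFactorial k : ℝ) ≠ 0 := by
    rw [Nat.cast_ne_zero]; exact (Nat.descFactorial_pos.2 hk).ne'
  have h2 : ((n - w).descFactorial k : ℝ) ≠ 0 := by
    rw [Nat.cast_ne_zero]; exact (Nat.descFactorial_pos.2 (by omega)).ne'
  rw [dualEigenvalue]
  field_simp
  linear_combination (eigenspaceDim n k : ℝ) * h

theorem eigenspaceDim_pos {n w k : ℕ} (hwn : 2 * w ≤ n) (hk : k ≤ w) :
    0 < eigenspaceDim n k := by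
  rw [eigenspaceDim]
  cases k with
  | zero => simp
  | succ k =>
    have h := Nat.choose_succ_right_eq n k
    have hp : 0 < n.choose k := Nat.choose_pos (by omega)
    have : n.choose k < n.choose (k + 1) := by
      by_contra! hc
      have h1 : n.choose k * (k + 2) ≤ n.choose k * (n - k) :=
        Nat.mul_le_mul_left _ (by omega)
      have h2 := Nat.mul_le_mul_right (k + 1) hc
      nlinarith
    simp only [Nat.add_one_ne_zero, if_false, Nat.add_sub_cancel]
    have : (n.choose k : ℤ) < n.choose (k + 1) := by exact_mod_cast this
    linarith

theorem dualEigenvalue_coeff_pos {n w k : ℕ} (hwn : 2 * w ≤ n) (hk : k ≤ w) :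
    0 < (eigenspaceDim n k : ℝ) / (w.descFactorial k * (n - w).descFactorial k) := by
  have h1 : (0 : ℝ) < w.descFactorial k := by exact_mod_cast Nat.descFactorial_pos.2 hk
  have h2 : (0 : ℝ) < (n - w).descFactorial k := by
    exact_mod_cast Nat.descFactorial_pos.2 (by omega)
  have h3 : (0 : ℝ) < eigenspaceDim n k := by exact_mod_cast eigenspaceDim_pos hwn hk
  positivity

/-! ### Boundedness of the feasible set and existence of the maximum -/

/-- The linear functional `f ↦ ∑ a_i f(i)` evaluated at a zonal function. -/
noncomputable def zonalMoment (n w : ℕ) (a : ℕ → ℝ) (t k : ℕ) : ℝ :=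
  ∑ i ∈ Finset.range (w + 1), a i * zonal t k (w - i) i i (n - w - i)

/-- For the type counts (w-i, i, i, n-w-i), the coefficients in `zonal_shift` do not depend on i, so
the identity survives summation against `a`. -/
theorem zonalMoment_shift {n w : ℕ} (hwn : 2 * w ≤ n) (a : ℕ → ℝ) (t k : ℕ) :
    ((n : ℝ) - t - 2 * k) * zonalMoment n w a (t + 1) k =
      zonalMoment n w a t (k + 1) + ((w : ℝ) - t - k) ^ 2 * zonalMoment n w a t k := by
  simp only [zonalMoment]
  rw [Finset.mul_sum, Finset.mul_sum, ← Finset.sum_add_distrib]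
  refine Finset.sum_congr rfl fun i hi => ?_
  have hi : i ≤ w := by have := Finset.mem_range.1 hi; omega
  have h := zonal_shift t k (w - i) i i (n - w - i)
  have e1 : ((w - i : ℕ) : ℝ) = w - i := Nat.cast_sub hi
  have e2 : ((n - w - i : ℕ) : ℝ) = n - w - i := by
    rw [Nat.cast_sub (by omega), Nat.cast_sub (by omega)]
  rw [e1, e2] at h
  linear_combination a i * h

theorem DelsarteConstraints.zonalMoment_zero_nonneg {n w e : ℕ} {a : ℕ → ℝ} (hwn : 2 * w ≤ n)
    (ha : DelsarteConstraints n w e a) {k : ℕ} (hk : k ≤ w) : 0 ≤ zonalMoment n w a 0 k := by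
  have h := ha.delsarte k hk
  have hc := dualEigenvalue_coeff_pos hwn hk
  have : ∑ i ∈ Finset.range (w + 1), a i * dualEigenvalue n w k i =
      (eigenspaceDim n k : ℝ) / (w.descFactorial k * (n - w).descFactorial k) *
        zonalMoment n w a 0 k := by
    rw [zonalMoment, Finset.mul_sum]
    refine Finset.sum_congr rfl fun i hi => ?_
    rw [dualEigenvalue_eq hwn (by have := Finset.mem_range.1 hi; omega) hk]
    ring
  rw [this] at h
  exact nonneg_of_mul_nonneg_right h hc

theorem DelsarteConstraints.zonalMoment_nonneg {n w e : ℕ} {a : ℕ → ℝ} (hwn : 2 * w ≤ n)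
    (ha : DelsarteConstraints n w e a) (t : ℕ) :
    ∀ k, t + k ≤ w → 0 ≤ zonalMoment n w a t k := by
  induction t with
  | zero => exact fun k hk => ha.zonalMoment_zero_nonneg hwn (by omega)
  | succ t ih =>
    intro k hk
    have h := zonalMoment_shift hwn a t k
    have hr : (0 : ℝ) < (n : ℝ) - t - 2 * k := by
      have : ((t + 2 * k + 1 : ℕ) : ℝ) ≤ n := by exact_mod_cast (by omega)
      push_cast at this
      linarith
    refine nonneg_of_mul_nonneg_right (a := (n : ℝ) - t - 2 * k) ?_ hr
    rw [h]
    exact add_nonneg (ih _ (by omega)) (mul_nonneg (sq_nonneg _) (ih _ (by omega)))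

/-- At k = 0 the recurrence contains the nonnegative moment of index (t, 1); dropping it bounds each
moment (t+1, 0) below by a multiple of (t, 0). For t = w the moment sees only `a 0`, while for t = 0
it is the sum of all a_i, so feasible sequences are uniformly bounded. -/
theorem exists_mul_zonalMoment_le {n w : ℕ} (hwn : 2 * w ≤ n) (t : ℕ) (ht : t ≤ w) :
    ∃ c : ℝ, 0 < c ∧ ∀ e a, DelsarteConstraints n w e a →
      c * zonalMoment n w a 0 0 ≤ zonalMoment n w a t 0 := by
  induction t with
  | zero => exact ⟨1, one_pos, fun e a _ => by rw [one_mul]⟩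
  | succ t ih =>
    obtain ⟨c, hc, h⟩ := ih (by omega)
    have hr : (0 : ℝ) < (n : ℝ) - t := by
      have : ((t + 1 : ℕ) : ℝ) ≤ n := by exact_mod_cast (by omega)
      push_cast at this
      linarith
    have hm : (0 : ℝ) < (w : ℝ) - t := by
      have : ((t + 1 : ℕ) : ℝ) ≤ w := by exact_mod_cast ht
      push_cast at this
      linarith
    refine ⟨((w : ℝ) - t) ^ 2 * c / (n - t), by positivity, fun e a ha => ?_⟩
    have h1 := h e a ha
    have h2 := zonalMoment_shift hwn a t 0
    have h3 := ha.zonalMoment_nonneg hwn t (0 + 1) (by omega)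
    rw [div_mul_eq_mul_div, div_le_iff₀ hr]
    simp only [Nat.cast_zero, mul_zero, sub_zero] at h2
    have h4 := mul_le_mul_of_nonneg_left h1 (sq_nonneg ((w : ℝ) - t))
    linarith

theorem zonalMoment_zero_zero (n w : ℕ) (a : ℕ → ℝ) :
    zonalMoment n w a 0 0 = ∑ i ∈ Finset.range (w + 1), a i := by
  simp [zonalMoment, zonal]

theorem zonalMoment_top (n w : ℕ) (a : ℕ → ℝ) :
    zonalMoment n w a w 0 = a 0 * w.factorial := by
  rw [zonalMoment, Finset.sum_eq_single 0]
  · simp [zonal, Nat.descFactorial_self]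
  · intro i hi hi0
    simp only [zonal, Finset.mem_range] at *
    simp [Nat.descFactorial_of_lt (show w - i < w by omega)]
  · simp

theorem exists_forall_delsarteConstraints_le {n w : ℕ} (hwn : 2 * w ≤ n) :
    ∃ B : ℝ, ∀ e a, DelsarteConstraints n w e a → ∀ i, a i ≤ B := by
  obtain ⟨c, hc, h⟩ := exists_mul_zonalMoment_le hwn w le_rfl
  refine ⟨w.factorial / c, fun e a ha i => ?_⟩
  rcases lt_or_ge w i with hi | hi
  · rw [ha.beyond i hi]; positivity
  · have h1 := h e a ha
    rw [zonalMoment_top, zonalMoment_zero_zero, ha.zero_eq_one, one_mul] at h1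
    rw [le_div_iff₀ hc, mul_comm]
    refine le_trans (mul_le_mul_of_nonneg_left ?_ hc.le) h1
    exact Finset.single_le_sum (fun j _ => ha.nonneg j) (Finset.mem_range.2 (by omega))

theorem dualEigenvalue_zero {n w k : ℕ} (hwn : 2 * w ≤ n) (hk : k ≤ w) :
    0 ≤ dualEigenvalue n w k 0 := by
  rw [dualEigenvalue_eq hwn (Nat.zero_le _) hk]
  refine mul_nonneg (dualEigenvalue_coeff_pos hwn hk).le ?_
  refine Finset.sum_nonneg fun j _ => ?_
  cases j with
  | zero => simp; positivity
  | succ j => simp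

theorem delsarteConstraints_trivial {n w : ℕ} (hwn : 2 * w ≤ n) (e : ℕ) :
    DelsarteConstraints n w e (Pi.single 0 1) where
  zero_eq_one := by simp
  gap i hi _ := by simp [Pi.single_apply]; omega
  beyond i hi := by simp [Pi.single_apply]; omega
  nonneg i := by by_cases h : i = 0 <;> simp [h]
  delsarte k hk := by
    rw [Finset.sum_eq_single 0]
    · simpa using dualEigenvalue_zero hwn hk
    · intro i _ hi; simp [hi]
    · simp

theorem isClosed_delsarteConstraints (n w e : ℕ) :
    IsClosed {a : ℕ → ℝ | DelsarteConstraints n w e a} := by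
  have : {a : ℕ → ℝ | DelsarteConstraints n w e a} =
      {a | a 0 = 1} ∩ (⋂ i, ⋂ (_ : 1 ≤ i), ⋂ (_ : i < 2 * e + 1), {a | a i = 0}) ∩
      (⋂ i, ⋂ (_ : w < i), {a | a i = 0}) ∩ (⋂ i, {a | 0 ≤ a i}) ∩
      (⋂ k, ⋂ (_ : k ≤ w),
        {a | 0 ≤ ∑ i ∈ Finset.range (w + 1), a i * dualEigenvalue n w k i}) := by
    ext a
    simp only [Set.mem_ofPred_eq, Set.mem_inter_iff, Set.mem_iInter]
    exact ⟨fun h => ⟨⟨⟨⟨h.1, h.2⟩, h.3⟩, h.4⟩, h.5⟩,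
      fun h => ⟨h.1.1.1.1, h.1.1.1.2, h.1.1.2, h.1.2, h.2⟩⟩
  rw [this]
  refine IsClosed.inter (IsClosed.inter (IsClosed.inter (IsClosed.inter ?_ ?_) ?_) ?_) ?_
  · exact isClosed_eq (continuous_apply 0) continuous_const
  · exact isClosed_iInter fun i => isClosed_iInter fun _ => isClosed_iInter fun _ =>
      isClosed_eq (continuous_apply i) continuous_const
  · exact isClosed_iInter fun i => isClosed_iInter fun _ =>
      isClosed_eq (continuous_apply i) continuous_const
  · exact isClosed_iInter fun i => isClosed_le continuous_const (continuous_apply i)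
  · exact isClosed_iInter fun k => isClosed_iInter fun _ =>
      isClosed_le continuous_const (by fun_prop)

theorem exists_isGreatest_lpValues {n w : ℕ} (hwn : 2 * w ≤ n) (e : ℕ) :
    ∃ U : ℝ, IsGreatest (lpValues n w e) U := by
  obtain ⟨B, hB⟩ := exists_forall_delsarteConstraints_le hwn
  have hcomp : IsCompact {a : ℕ → ℝ | DelsarteConstraints n w e a} :=
    -- The feasible set is closed in a product of intervals [0, B], compact by Tychonoff.
    (isCompact_univ_pi fun _ => isCompact_Icc (a := (0 : ℝ)) (b := B)).of_isClosed_subset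
      (isClosed_delsarteConstraints n w e)
      fun a ha i _ => ⟨DelsarteConstraints.nonneg ha i, hB e a ha i⟩
  have himg : lpValues n w e =
      (fun a : ℕ → ℝ => a (2 * e + 1)) '' {a : ℕ → ℝ | DelsarteConstraints n w e a} := rfl
  rw [himg]
  exact (hcomp.image (continuous_apply _)).exists_isGreatest
    ⟨_, _, delsarteConstraints_trivial hwn e, rfl⟩

/-! ### Positive semidefinite zonal kernels -/

section Kernel

variable {α : Type*} [DecidableEq α]

/-- The sum over all sequences of `k` disjoint ordered pairs `(a, b)` in `R` of
`∏ (x_a - x_b) (y_a - y_b)`, where `x`, `y` are the indicators of `X`, `Y`. -/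
noncomputable def zonalKernel : ℕ → Finset α → Finset α → Finset α → ℝ
  | 0, _, _, _ => 1
  | k + 1, R, X, Y => ∑ a ∈ R, ∑ b ∈ R.erase a,
      ((if a ∈ X then 1 else 0) - (if b ∈ X then 1 else 0)) *
        ((if a ∈ Y then 1 else 0) - (if b ∈ Y then 1 else 0)) *
          zonalKernel k ((R.erase a).erase b) X Y

/-- For fixed (a, b) the two differences are absorbed into the weights `u X` and `u Y`; this is why
the induction needs arbitrary `u`. The base case is a square. -/
theorem sum_zonalKernel_nonneg (C : Finset (Finset α)) (k : ℕ) :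
    ∀ (R : Finset α) (u : Finset α → ℝ),
      0 ≤ ∑ X ∈ C, ∑ Y ∈ C, u X * u Y * zonalKernel k R X Y := by
  induction k with
  | zero =>
    intro R u
    simp only [zonalKernel, mul_one]
    rw [← Finset.sum_mul_sum]
    exact mul_self_nonneg _
  | succ k ih =>
    intro R u
    have : ∑ X ∈ C, ∑ Y ∈ C, u X * u Y * zonalKernel (k + 1) R X Y =
        ∑ a ∈ R, ∑ b ∈ R.erase a, ∑ X ∈ C, ∑ Y ∈ C,
          (u X * ((if a ∈ X then 1 else 0) - (if b ∈ X then 1 else 0))) *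
          (u Y * ((if a ∈ Y then 1 else 0) - (if b ∈ Y then 1 else 0))) *
            zonalKernel k ((R.erase a).erase b) X Y := by
      simp only [zonalKernel, Finset.mul_sum]
      rw [Finset.sum_congr rfl fun X _ => Finset.sum_comm, Finset.sum_comm]
      refine Finset.sum_congr rfl fun a _ => ?_
      rw [Finset.sum_congr rfl fun X _ => Finset.sum_comm, Finset.sum_comm]
      refine Finset.sum_congr rfl fun b _ => Finset.sum_congr rfl fun X _ =>
        Finset.sum_congr rfl fun Y _ => ?_
      ring
    rw [this]
    exact Finset.sum_nonneg fun a _ => Finset.sum_nonneg fun b _ =>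
      ih _ fun X => u X * ((if a ∈ X then 1 else 0) - (if b ∈ X then 1 else 0))

theorem zonalKernel_eq (X Y : Finset α) (k : ℕ) : ∀ R : Finset α,
    zonalKernel k R X Y = 2 ^ k * zonal 0 k {a ∈ R | a ∈ X ∧ a ∈ Y}.card
      {a ∈ R | a ∈ X ∧ a ∉ Y}.card {a ∈ R | a ∉ X ∧ a ∈ Y}.card
      {a ∈ R | a ∉ X ∧ a ∉ Y}.card := by
  induction k with
  | zero => intro R; simp [zonalKernel, zonal]
  | succ k ih =>
    intro R
    set n₁₁ := {a ∈ R | a ∈ X ∧ a ∈ Y}.card with h₁₁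
    set n₁₀ := {a ∈ R | a ∈ X ∧ a ∉ Y}.card with h₁₀
    set n₀₁ := {a ∈ R | a ∉ X ∧ a ∈ Y}.card with h₀₁
    set n₀₀ := {a ∈ R | a ∉ X ∧ a ∉ Y}.card with h₀₀
    set u : ℝ := 2 ^ k * zonal 0 k (n₁₁ - 1) n₁₀ n₀₁ (n₀₀ - 1) with hu
    set v : ℝ := 2 ^ k * zonal 0 k n₁₁ (n₁₀ - 1) (n₀₁ - 1) n₀₀ with hv
    let p₁₁ : α → ℝ := fun a => if a ∈ X ∧ a ∈ Y then 1 else 0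
    let p₁₀ : α → ℝ := fun a => if a ∈ X ∧ a ∉ Y then 1 else 0
    let p₀₁ : α → ℝ := fun a => if a ∉ X ∧ a ∈ Y then 1 else 0
    let p₀₀ : α → ℝ := fun a => if a ∉ X ∧ a ∉ Y then 1 else 0
    -- A pair (a, b) contributes only if it has opposite types: +1 for (1,1) with (0,0), -1 for
    -- (1,0) with (0,1). The two orders give the factor 2, and the terms b = a added here vanish.
    have key : zonalKernel (k + 1) R X Y = ∑ a ∈ R, ∑ b ∈ R,
        (p₁₁ a * p₀₀ b * u + p₀₀ a * p₁₁ b * u - p₁₀ a * p₀₁ b * v - p₀₁ a * p₁₀ b * v) := by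
      rw [zonalKernel]
      refine Finset.sum_congr rfl fun a ha => ?_
      rw [← Finset.sum_erase (s := R) (a := a)]
      swap
      · by_cases h1 : a ∈ X <;> by_cases h2 : a ∈ Y <;> simp [p₁₁, p₁₀, p₀₁, p₀₀, h1, h2]
      refine Finset.sum_congr rfl fun b hb => ?_
      obtain ⟨hba, hb⟩ := Finset.mem_erase.1 hb
      rw [ih]
      simp only [Finset.filter_erase, Finset.card_erase_eq_ite, Finset.mem_erase,
        Finset.mem_filter, ha, hb, hba, ne_eq, not_false_eq_true, true_and, ← h₁₁, ← h₁₀, ← h₀₁,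
        ← h₀₀]
      by_cases h1 : a ∈ X <;> by_cases h2 : a ∈ Y <;> by_cases h3 : b ∈ X <;>
        by_cases h4 : b ∈ Y <;> simp [p₁₁, p₁₀, p₀₁, p₀₀, h1, h2, h3, h4, u, v]
    have s₁₁ : ∑ a ∈ R, p₁₁ a = n₁₁ := Finset.sum_boole _ _
    have s₁₀ : ∑ a ∈ R, p₁₀ a = n₁₀ := Finset.sum_boole _ _
    have s₀₁ : ∑ a ∈ R, p₀₁ a = n₀₁ := Finset.sum_boole _ _
    have s₀₀ : ∑ a ∈ R, p₀₀ a = n₀₀ := Finset.sum_boole _ _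
    rw [key, zonal_zero_succ]
    simp only [Finset.sum_add_distrib, Finset.sum_sub_distrib, ← Finset.sum_mul,
      ← Finset.mul_sum, s₁₁, s₁₀, s₀₁, s₀₀]
    rw [hu, hv]
    ring

end Kernel

/-! ### Spheres, geodesics and the packing count -/

section Counting

variable {α : Type*} [DecidableEq α]

theorem card_sdiff_triangle (X Y Z : Finset α) :
    (X \ Z).card ≤ (X \ Y).card + (Y \ Z).card :=
  (Finset.card_le_card fun a ha => by
    simp only [Finset.mem_union, Finset.mem_sdiff] at *; tauto).trans (Finset.card_union_le _ _)

theorem eq_of_card_sdiff_eq_zero {X Y : Finset α} (h : X.card = Y.card)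
    (h0 : (X \ Y).card = 0) : X = Y :=
  Finset.eq_of_subset_of_card_le (Finset.sdiff_eq_empty_iff_subset.1 (Finset.card_eq_zero.1 h0))
    h.ge

variable [Fintype α]

theorem card_sphere {w : ℕ} {X : Finset α} (hX : X.card = w) (i : ℕ) :
    {Z ∈ Finset.powersetCard w (Finset.univ : Finset α) | (X \ Z).card = i}.card =
      valency (Fintype.card α) w i := by
  have hc : Xᶜ.card = Fintype.card α - w := by rw [Finset.card_compl, hX]
  rw [valency, ← hc, ← hX, ← Finset.card_powersetCard, ← Finset.card_powersetCard,
    ← Finset.card_product]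
  have hd : ∀ A B : Finset α, A ⊆ X → B ⊆ Xᶜ →
      X \ (X \ A ∪ B) = A ∧ (X \ A ∪ B) \ X = B := by
    intro A B hA hB
    constructor <;> ext a <;> have h1 := @hA a <;> have h2 := @hB a <;>
      simp only [Finset.mem_sdiff, Finset.mem_union, Finset.mem_compl] at * <;> tauto
  refine Finset.card_nbij' (fun Z => (X \ Z, Z \ X)) (fun p => X \ p.1 ∪ p.2) ?_ ?_ ?_ ?_
  · intro Z hZ
    simp only [Finset.coe_filter, Set.mem_ofPred_eq, Finset.coe_product, Set.mem_prod,
      Finset.mem_coe, Finset.mem_powersetCard, Finset.subset_univ, true_and] at *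
    exact ⟨⟨Finset.sdiff_subset, hZ.2⟩,
      fun a ha => Finset.mem_compl.2 (Finset.mem_sdiff.1 ha).2,
      (Finset.card_sdiff_comm hZ.1).trans hZ.2⟩
  · rintro ⟨A, B⟩ hp
    simp only [Finset.coe_filter, Set.mem_ofPred_eq, Finset.coe_product, Set.mem_prod,
      Finset.mem_coe, Finset.mem_powersetCard, Finset.subset_univ, true_and] at *
    obtain ⟨⟨hA, hAi⟩, hB, hBi⟩ := hp
    rw [(hd A B hA hB).1]
    refine ⟨?_, hAi⟩
    rw [Finset.card_union_of_disjoint, Finset.card_sdiff_of_subset hA]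
    · have := Finset.card_le_card hA
      omega
    · rw [Finset.disjoint_left]
      intro a ha hb
      exact Finset.mem_compl.1 (hB hb) (Finset.mem_sdiff.1 ha).1
  · intro Z _
    ext a
    simp only [Finset.mem_sdiff, Finset.mem_union]
    tauto
  · rintro ⟨A, B⟩ hp
    simp only [Finset.coe_product, Set.mem_prod, Finset.mem_coe,
      Finset.mem_powersetCard] at hp
    exact Prod.ext (hd A B hp.1.1 hp.2.1).1 (hd A B hp.1.1 hp.2.1).2

theorem card_ball {w : ℕ} {X : Finset α} (hX : X.card = w) (e : ℕ) :
    {Z ∈ Finset.powersetCard w (Finset.univ : Finset α) | (X \ Z).card ≤ e}.card =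
      ∑ i ∈ Finset.range (e + 1), valency (Fintype.card α) w i := by
  rw [Finset.card_eq_sum_card_fiberwise (f := fun Z => (X \ Z).card)
    (t := Finset.range (e + 1))]
  · refine Finset.sum_congr rfl fun i hi => ?_
    rw [← card_sphere hX, Finset.filter_filter]
    congr 1
    refine Finset.filter_congr fun Z _ => ?_
    have := Finset.mem_range.1 hi
    constructor
    · exact fun h => h.2
    · exact fun h => ⟨by omega, h⟩
  · intro Z hZ
    have := (Finset.mem_filter.1 hZ).2
    exact Finset.mem_coe.2 (Finset.mem_range.2 (Nat.lt_succ_of_le this))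

/-- Equality in the triangle inequality makes Z determined by an e-subset Z \ Y of X \ Y and an
(e+1)-subset Z \ X of Y \ X. -/
theorem card_geodesic_le {w e : ℕ} {X Y : Finset α} (hX : X.card = w) (hY : Y.card = w)
    (hXY : (X \ Y).card = 2 * e + 1) :
    {Z ∈ Finset.powersetCard w (Finset.univ : Finset α) |
      (X \ Z).card = e + 1 ∧ (Y \ Z).card ≤ e}.card ≤ (2 * e + 1).choose e ^ 2 := by
  have hYX : (Y \ X).card = 2 * e + 1 := (Finset.card_sdiff_comm (hY.trans hX.symm)).trans hXY
  have hc : (2 * e + 1).choose e ^ 2 =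
      (Finset.powersetCard e (X \ Y) ×ˢ Finset.powersetCard (e + 1) (Y \ X)).card := by
    rw [Finset.card_product, Finset.card_powersetCard, Finset.card_powersetCard, hXY, hYX,
      sq, ← Nat.choose_symm_half e]
  have hs : ∀ Z ∈ {Z ∈ Finset.powersetCard w (Finset.univ : Finset α) |
      (X \ Z).card = e + 1 ∧ (Y \ Z).card ≤ e},
      X \ Y = (X \ Z) ∪ (Z \ Y) ∧ (Z \ Y).card = e ∧ (Z \ X).card = e + 1 := by
    intro Z hZ
    simp only [Finset.mem_filter, Finset.mem_powersetCard_univ] at hZ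
    obtain ⟨hZ, h1, h2⟩ := hZ
    have h3 := Finset.card_sdiff_comm (hZ.trans hX.symm)
    have h4 := Finset.card_sdiff_comm (hZ.trans hY.symm)
    have h5 := Finset.card_union_le (X \ Z) (Z \ Y)
    have hsub : X \ Y ⊆ (X \ Z) ∪ (Z \ Y) := fun a ha => by
      simp only [Finset.mem_union, Finset.mem_sdiff] at *; tauto
    have h6 := Finset.card_le_card hsub
    exact ⟨Finset.eq_of_subset_of_card_le hsub (by omega), by omega, by omega⟩
  have hs' : ∀ Z ∈ {Z ∈ Finset.powersetCard w (Finset.univ : Finset α) |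
      (X \ Z).card = e + 1 ∧ (Y \ Z).card ≤ e}, ∀ a,
      (a ∈ X ∧ a ∉ Y) ↔ ((a ∈ X ∧ a ∉ Z) ∨ (a ∈ Z ∧ a ∉ Y)) := by
    intro Z hZ a
    have := Finset.ext_iff.1 (hs Z hZ).1 a
    simpa only [Finset.mem_union, Finset.mem_sdiff] using this
  rw [hc]
  refine Finset.card_le_card_of_injOn (fun Z => (Z \ Y, Z \ X)) ?_ ?_
  · intro Z hZ
    have h1 := hs Z hZ
    simp only [Finset.coe_product, Set.mem_prod, Finset.mem_coe, Finset.mem_powersetCard]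
    refine ⟨⟨?_, h1.2.1⟩, ?_, h1.2.2⟩
    · rw [h1.1]; exact Finset.subset_union_right
    · intro a ha
      have := hs' Z hZ a
      simp only [Finset.mem_sdiff] at *
      tauto
  · intro Z hZ Z' hZ' h
    ext a
    have h1 := hs' Z hZ a
    have h2 := hs' Z' hZ' a
    have h3 := Finset.ext_iff.1 (Prod.ext_iff.1 h).1 a
    have h4 := Finset.ext_iff.1 (Prod.ext_iff.1 h).2 a
    simp only [Finset.mem_sdiff] at h3 h4
    by_cases hx : a ∈ X <;> by_cases hy : a ∈ Y <;> simp_all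

theorem packing_inequality {w e T : ℕ} {C : Finset (Finset α)} (hC : ∀ X ∈ C, X.card = w)
    (hd : ∀ X ∈ C, ∀ Y ∈ C, X ≠ Y → 2 * e + 1 ≤ (X \ Y).card)
    (hT : ∀ Z : Finset α, Z.card = w → {X ∈ C | (X \ Z).card = e + 1}.card ≤ T) :
    ∃ r : ℕ, C.card * ∑ i ∈ Finset.range (e + 1), valency (Fintype.card α) w i + r =
        (Fintype.card α).choose w ∧
      C.card * valency (Fintype.card α) w (e + 1) ≤
        T * r + {p ∈ C ×ˢ C | (p.1 \ p.2).card = 2 * e + 1}.card *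
          (2 * e + 1).choose e ^ 2 := by
  set P := Finset.powersetCard w (Finset.univ : Finset α) with hP
  set B := C.biUnion fun X => {Z ∈ P | (X \ Z).card ≤ e} with hB
  have hBP : B ⊆ P := Finset.biUnion_subset.2 fun X _ => Finset.filter_subset _ _
  have hBc : B.card = C.card * ∑ i ∈ Finset.range (e + 1), valency (Fintype.card α) w i := by
    rw [hB, Finset.card_biUnion, Finset.sum_congr rfl fun X hX => card_ball (hC X hX) e,
      Finset.sum_const, smul_eq_mul]
    intro X hX Y hY hXY
    rw [Function.onFun, Finset.disjoint_left]
    intro Z hZ hZ'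
    simp only [Finset.mem_filter, hP, Finset.mem_powersetCard_univ] at hZ hZ'
    have h1 := hd X hX Y hY hXY
    have h2 := card_sdiff_triangle X Z Y
    have h3 := Finset.card_sdiff_comm (hZ.1.trans (hC Y hY).symm)
    omega
  refine ⟨(P \ B).card, ?_, ?_⟩
  · rw [← hBc, add_comm, Finset.card_sdiff_add_card_eq_card hBP, hP,
      Finset.card_powersetCard, Finset.card_univ]
  set S := {p ∈ C ×ˢ P | (p.1 \ p.2).card = e + 1} with hS
  have hSc : S.card = C.card * valency (Fintype.card α) w (e + 1) := by
    rw [hS, Finset.card_filter, Finset.sum_product]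
    simp only [← Finset.card_filter]
    rw [Finset.sum_congr rfl fun X hX => card_sphere (hC X hX) (e + 1), Finset.sum_const,
      smul_eq_mul]
  -- Split the pairs (X, Z) by whether Z is uncovered.
  rw [← hSc, ← Finset.card_filter_add_card_filter_not (s := S) (fun p => p.2 ∉ B)]
  refine add_le_add ?_ ?_
  · refine Finset.card_le_mul_card_image_of_maps_to (f := Prod.snd) ?_ T ?_
    · rintro ⟨X, Z⟩ hp
      simp only [hS, Finset.mem_filter, Finset.mem_product] at hp
      exact Finset.mem_sdiff.2 ⟨hp.1.1.2, hp.2⟩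
    · intro Z hZ
      refine le_trans ?_ (hT Z (Finset.mem_powersetCard_univ.1 (Finset.mem_sdiff.1 hZ).1))
      refine Finset.card_le_card_of_injOn Prod.fst ?_ ?_
      · rintro ⟨X, Z'⟩ hp
        simp only [hS, Finset.mem_filter, Finset.mem_product, Finset.mem_coe] at *
        obtain ⟨⟨⟨⟨hX, -⟩, h⟩, -⟩, rfl⟩ := hp
        exact ⟨hX, h⟩
      · rintro ⟨X, Z₁⟩ h₁ ⟨Y, Z₂⟩ h₂ h
        exact Prod.ext h
          ((Finset.mem_filter.1 h₁).2.trans (Finset.mem_filter.1 h₂).2.symm)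
  · refine le_trans (Finset.card_le_card (t := {p ∈ C ×ˢ C | (p.1 \ p.2).card = 2 * e + 1}.biUnion
      fun p => {Z ∈ P | (p.1 \ Z).card = e + 1 ∧ (p.2 \ Z).card ≤ e}.image fun Z => (p.1, Z)) ?_)
      (Finset.card_biUnion_le_card_mul _ _ _ ?_)
    · rintro ⟨X, Z⟩ hp
      simp only [hS, hB, Finset.mem_filter, Finset.mem_product, not_not,
        Finset.mem_biUnion] at hp
      obtain ⟨⟨⟨hX, hZ⟩, h⟩, Y, hY, -, hYZ⟩ := hp
      -- Z is at distance e+1 from X but at most e from Y; the triangle inequality and the minimum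
      -- distance then give d(X, Y) = 2e+1 exactly.
      have hne : X ≠ Y := by rintro rfl; omega
      have h1 := hd X hX Y hY hne
      have h2 := card_sdiff_triangle X Z Y
      have h3 := Finset.card_sdiff_comm
        ((Finset.mem_powersetCard_univ.1 hZ).trans (hC Y hY).symm)
      refine Finset.mem_biUnion.2 ⟨(X, Y), ?_, Finset.mem_image.2 ⟨Z, ?_, rfl⟩⟩
      · exact Finset.mem_filter.2 ⟨Finset.mem_product.2 ⟨hX, hY⟩, by dsimp only; omega⟩
      · exact Finset.mem_filter.2 ⟨hZ, h, hYZ⟩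
    · rintro ⟨X, Y⟩ hp
      obtain ⟨hp, h⟩ := Finset.mem_filter.1 hp
      obtain ⟨hX, hY⟩ := Finset.mem_product.1 hp
      exact Finset.card_image_le.trans (card_geodesic_le (hC X hX) (hC Y hY) h)

/-! ### Delsarte's inequalities for codes -/

/-- The distance distribution of a family of sets of equal size. -/
noncomputable def distanceDistribution (C : Finset (Finset α)) (i : ℕ) : ℝ :=
  {p ∈ C ×ˢ C | (p.1 \ p.2).card = i}.card / C.card

theorem zonalKernel_univ {w : ℕ} {X Y : Finset α} (hX : X.card = w) (hY : Y.card = w) (k : ℕ) :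
    zonalKernel k Finset.univ X Y = 2 ^ k * zonal 0 k (w - (X \ Y).card) (X \ Y).card
      (X \ Y).card (Fintype.card α - w - (X \ Y).card) := by
  have e₁₁ : ({a | a ∈ X ∧ a ∈ Y} : Finset α).card = w - (X \ Y).card := by
    rw [← hX, Finset.card_sdiff, Nat.sub_sub_self (Finset.card_le_card Finset.inter_subset_right),
      Finset.inter_comm]
    congr 1; ext a; simp
  have e₁₀ : ({a | a ∈ X ∧ a ∉ Y} : Finset α).card = (X \ Y).card := by congr 1; ext a; simp
  have e₀₁ : ({a | a ∉ X ∧ a ∈ Y} : Finset α).card = (X \ Y).card := by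
    rw [Finset.card_sdiff_comm (hX.trans hY.symm)]; congr 1; ext a; simp [and_comm]
  have e₀₀ : ({a | a ∉ X ∧ a ∉ Y} : Finset α).card = Fintype.card α - w - (X \ Y).card := by
    have h1 : ({a | a ∉ X ∧ a ∉ Y} : Finset α) = (Y ∪ X \ Y)ᶜ := by
      ext a
      simp only [Finset.mem_filter_univ, Finset.mem_compl, Finset.mem_union, Finset.mem_sdiff]
      tauto
    rw [h1, Finset.card_compl, Finset.card_union_of_disjoint Finset.disjoint_sdiff, hY,
      Nat.sub_sub]
  rw [zonalKernel_eq, e₁₁, e₁₀, e₀₁, e₀₀]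

theorem delsarteConstraints_distanceDistribution {w e : ℕ} {C : Finset (Finset α)}
    (hwn : 2 * w ≤ Fintype.card α) (hne : C.Nonempty) (hC : ∀ X ∈ C, X.card = w)
    (hd : ∀ X ∈ C, ∀ Y ∈ C, X ≠ Y → 2 * e + 1 ≤ (X \ Y).card) :
    DelsarteConstraints (Fintype.card α) w e (distanceDistribution C) where
  zero_eq_one := by
    have h : {p ∈ C ×ˢ C | (p.1 \ p.2).card = 0} = C.diag := by
      ext ⟨X, Y⟩
      simp only [Finset.mem_filter, Finset.mem_product, Finset.mem_diag]
      constructor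
      · rintro ⟨⟨hX, hY⟩, h⟩
        exact ⟨hX, eq_of_card_sdiff_eq_zero ((hC X hX).trans (hC Y hY).symm) h⟩
      · rintro ⟨hX, rfl⟩
        simpa using hX
    rw [distanceDistribution, h, Finset.diag_card]
    exact div_self (Nat.cast_ne_zero.2 hne.card_pos.ne')
  gap i h1 h2 := by
    rw [distanceDistribution, Finset.filter_eq_empty_iff.2]
    · simp
    · rintro ⟨X, Y⟩ hp h
      obtain ⟨hX, hY⟩ := Finset.mem_product.1 hp
      have hXY : X ≠ Y := by rintro rfl; simp at h; omega
      have := hd X hX Y hY hXY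
      dsimp only at h
      omega
  beyond i hi := by
    rw [distanceDistribution, Finset.filter_eq_empty_iff.2]
    · simp
    · rintro ⟨X, Y⟩ hp h
      have := hC X (Finset.mem_product.1 hp).1
      have := Finset.card_le_card (Finset.sdiff_subset (s := X) (t := Y))
      dsimp only at h
      omega
  nonneg i := by rw [distanceDistribution]; positivity
  delsarte k hk := by
    have hle : ∀ X ∈ C, ∀ Y : Finset α, (X \ Y).card ≤ w := fun X hX Y =>
      (Finset.card_le_card Finset.sdiff_subset).trans (hC X hX).le
    have h1 : ∑ i ∈ Finset.range (w + 1),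
        distanceDistribution C i * dualEigenvalue (Fintype.card α) w k i =
        (∑ p ∈ C ×ˢ C, dualEigenvalue (Fintype.card α) w k (p.1 \ p.2).card) / C.card := by
      rw [← Finset.sum_fiberwise_of_maps_to' (s := C ×ˢ C) (t := Finset.range (w + 1))
        (g := fun p => (p.1 \ p.2).card) ?_ (fun i => dualEigenvalue (Fintype.card α) w k i),
        Finset.sum_div]
      · refine Finset.sum_congr rfl fun i _ => ?_
        rw [distanceDistribution, Finset.sum_const, nsmul_eq_mul]
        ring
      · intro p hp
        have := hle p.1 (Finset.mem_product.1 hp).1 p.2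
        exact Finset.mem_range.2 (by omega)
    -- The factors `1 * 1` are the constant weights `u = 1` of `sum_zonalKernel_nonneg`; the
    -- division by 2^k undoes the ordering of the pairs in the kernel.
    have h2 : ∑ p ∈ C ×ˢ C, dualEigenvalue (Fintype.card α) w k (p.1 \ p.2).card =
        (eigenspaceDim (Fintype.card α) k : ℝ) /
            (w.descFactorial k * (Fintype.card α - w).descFactorial k) / 2 ^ k *
          ∑ X ∈ C, ∑ Y ∈ C, 1 * 1 * zonalKernel k Finset.univ X Y := by
      rw [Finset.sum_product, Finset.mul_sum]
      refine Finset.sum_congr rfl fun X hX => ?_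
      rw [Finset.mul_sum]
      refine Finset.sum_congr rfl fun Y hY => ?_
      rw [dualEigenvalue_eq hwn (hle X hX Y) hk, zonalKernel_univ (hC X hX) (hC Y hY)]
      field_simp
    rw [h1, h2]
    have h3 := dualEigenvalue_coeff_pos hwn hk
    exact div_nonneg (mul_nonneg (by positivity)
      (sum_zonalKernel_nonneg C k Finset.univ fun _ => 1)) (Nat.cast_nonneg _)

end Counting

/-! ### Translation between sets and binary words -/

section Words

theorem card_le_doublyConstWeightT {n w e : ℕ} {S : Finset (Finset (Fin n))} {Z : Finset (Fin n)}
    (hZ : Z.card = w) (hS : ∀ X ∈ S, X.card = w ∧ (X \ Z).card = e + 1)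
    (hd : ∀ X ∈ S, ∀ Y ∈ S, X ≠ Y → 2 * e + 1 ≤ (X \ Y).card) :
    S.card ≤ doublyConstWeightT (e + 1) w (e + 1) (n - w) (4 * e + 2) := by
  classical
  have f : Fin w ≃ {a // a ∈ Z} :=
    (Fintype.equivFinOfCardEq (by rw [Fintype.card_coe, hZ])).symm
  have g : Fin (n - w) ≃ {a // a ∉ Z} :=
    (Fintype.equivFinOfCardEq (by
      rw [Fintype.card_subtype_compl, Fintype.card_coe, hZ, Fintype.card_fin])).symm
  let σ : Fin w ⊕ Fin (n - w) ≃ Fin n := (Equiv.sumCongr f g).trans (Equiv.sumCompl (· ∈ Z))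
  have σl : ∀ i, σ (Sum.inl i) = f i := fun i => rfl
  have σr : ∀ i, σ (Sum.inr i) = g i := fun i => rfl
  -- The word of the symmetric difference of X and Z, with coordinates split into Z and its
  -- complement: translation by Z keeps Hamming distances, and both parts have weight e+1.
  let φ : Finset (Fin n) → (Fin w ⊕ Fin (n - w) → ZMod 2) :=
    fun X s => if (σ s ∈ X ↔ σ s ∈ Z) then 0 else 1
  have hdist : ∀ X Y : Finset (Fin n), X.card = Y.card →
      hammingDist (φ X) (φ Y) = 2 * (X \ Y).card := by
    intro X Y h
    have h1 : hammingDist (φ X) (φ Y) = (X \ Y ∪ Y \ X).card := by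
      rw [hammingDist]
      refine Finset.card_equiv σ fun s => ?_
      simp only [Finset.mem_filter_univ, φ, Finset.mem_union, Finset.mem_sdiff]
      by_cases h1 : σ s ∈ X <;> by_cases h2 : σ s ∈ Y <;> by_cases h3 : σ s ∈ Z <;>
        simp [h1, h2, h3]
    rw [h1, Finset.card_union_of_disjoint disjoint_sdiff_sdiff, Finset.card_sdiff_comm h.symm]
    ring
  have hφ : Set.InjOn φ S := by
    intro X hX Y hY h
    have hc := (hS X hX).1.trans (hS Y hY).1.symm
    have h1 := hdist X Y hc
    rw [h, hammingDist_self] at h1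
    exact eq_of_card_sdiff_eq_zero hc (by omega)
  rw [← Finset.card_image_of_injOn hφ, doublyConstWeightT]
  refine Finset.le_sup (f := Finset.card) (Finset.mem_filter.2 ⟨Finset.mem_univ _, ?_, ?_⟩)
  · intro x hx
    obtain ⟨X, hX, rfl⟩ := Finset.mem_image.1 hx
    obtain ⟨hXw, hXe⟩ := hS X hX
    constructor
    · rw [hammingNorm, ← hXe, Finset.card_sdiff_comm (hXw.trans hZ.symm)]
      refine Finset.card_nbij (fun i => (f i : Fin n)) ?_ ?_ ?_
      · intro i hi
        simpa [φ, σl] using hi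
      · intro i _ j _ h
        exact f.injective (Subtype.ext h)
      · intro a ha
        obtain ⟨haZ, haX⟩ := Finset.mem_sdiff.1 (Finset.mem_coe.1 ha)
        exact ⟨f.symm ⟨a, haZ⟩, by simp [φ, σl, haX], by simp⟩
    · rw [hammingNorm, ← hXe]
      refine Finset.card_nbij (fun i => (g i : Fin n)) ?_ ?_ ?_
      · intro i hi
        have := (g i).2
        simpa [φ, σr, this] using hi
      · intro i _ j _ h
        exact g.injective (Subtype.ext h)
      · intro a ha
        obtain ⟨haX, haZ⟩ := Finset.mem_sdiff.1 (Finset.mem_coe.1 ha)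
        exact ⟨g.symm ⟨a, haZ⟩, by simp [φ, σr, haX, haZ], by simp⟩
  · intro x hx y hy hxy
    obtain ⟨X, hX, rfl⟩ := Finset.mem_image.1 hx
    obtain ⟨Y, hY, rfl⟩ := Finset.mem_image.1 hy
    have := hd X hX Y hY (by rintro rfl; exact hxy rfl)
    rw [hdist X Y ((hS X hX).1.trans (hS Y hY).1.symm)]
    omega

theorem exists_family_card_eq_constWeightA (n w e : ℕ) :
    ∃ C : Finset (Finset (Fin n)), (∀ X ∈ C, X.card = w) ∧
      (∀ X ∈ C, ∀ Y ∈ C, X ≠ Y → 2 * e + 1 ≤ (X \ Y).card) ∧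
      C.card = constWeightA n (4 * e + 2) w := by
  classical
  let P : Finset (Finset (Fin n → ZMod 2)) := Finset.univ.filter fun C =>
    (∀ x ∈ C, hammingNorm x = w) ∧ HasMutualDistance (4 * e + 2) C
  have hP : P.Nonempty := ⟨∅,
    Finset.mem_filter.2 ⟨Finset.mem_univ _, by simp, by simp [HasMutualDistance]⟩⟩
  obtain ⟨C, hC, h⟩ := Finset.exists_mem_eq_sup P hP Finset.card
  have hA : constWeightA n (4 * e + 2) w = P.sup Finset.card := by
    rw [constWeightA]
  obtain ⟨-, hw, hd⟩ := Finset.mem_filter.1 hC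
  let supp : (Fin n → ZMod 2) → Finset (Fin n) := fun x => {i | x i ≠ 0}
  have hz : ∀ a b : ZMod 2, a ≠ b ↔ (a ≠ 0 ∧ b = 0) ∨ (b ≠ 0 ∧ a = 0) := by decide
  have hsupp : ∀ x y, hammingDist x y = (supp x \ supp y).card + (supp y \ supp x).card := by
    intro x y
    rw [← Finset.card_union_of_disjoint disjoint_sdiff_sdiff, hammingDist]
    congr 1
    ext i
    simp only [supp, Finset.mem_filter_univ, Finset.mem_union, Finset.mem_sdiff, not_not]
    exact hz _ _
  have hinj : Function.Injective supp := by
    intro x y hxy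
    have := hsupp x y
    rw [hxy] at this
    simpa using this
  refine ⟨C.image supp, ?_, ?_, ?_⟩
  · intro X hX
    obtain ⟨x, hx, rfl⟩ := Finset.mem_image.1 hX
    exact hw x hx
  · intro X hX Y hY hXY
    obtain ⟨x, hx, rfl⟩ := Finset.mem_image.1 hX
    obtain ⟨y, hy, rfl⟩ := Finset.mem_image.1 hY
    have h1 := hd x hx y hy (by rintro rfl; exact hXY rfl)
    have h2 : (supp x).card = (supp y).card := (hw x hx).trans (hw y hy).symm
    rw [hsupp, Finset.card_sdiff_comm h2.symm] at h1
    omega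
  · rw [Finset.card_image_of_injective _ hinj, hA, h]

end Words

theorem constWeightA_mul_boundDenominator_le {n w e : ℕ} (hwn : 2 * w ≤ n) {U : ℝ}
    (hU : U ∈ upperBounds (lpValues n w e)) :
    (constWeightA n (4 * e + 2) w : ℝ) * boundDenominator n w e U ≤ n.choose w := by
  obtain ⟨C, hC, hd, hcard⟩ := exists_family_card_eq_constWeightA n w e
  rw [← hcard]
  rcases C.eq_empty_or_nonempty with rfl | hne
  · simp
  set T := doublyConstWeightT (e + 1) w (e + 1) (n - w) (4 * e + 2) with hT
  obtain ⟨r, h1, h2⟩ := packing_inequality (T := T) hC hd fun Z hZ =>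
    card_le_doublyConstWeightT hZ
      (fun X hX => ⟨hC X (Finset.mem_filter.1 hX).1, (Finset.mem_filter.1 hX).2⟩)
      fun X hX Y hY => hd X (Finset.mem_filter.1 hX).1 Y (Finset.mem_filter.1 hY).1
  have hA : distanceDistribution C (2 * e + 1) ≤ U := by
    have h := delsarteConstraints_distanceDistribution (e := e) (by simpa using hwn) hne hC hd
    rw [Fintype.card_fin] at h
    exact hU ⟨_, h, rfl⟩
  have hM : (0 : ℝ) < C.card := Nat.cast_pos.2 hne.card_pos
  rw [distanceDistribution, div_le_iff₀ hM] at hA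
  rw [Fintype.card_fin] at h1 h2
  have h1' : (C.card : ℝ) * ∑ i ∈ Finset.range (e + 1), (w.choose i : ℝ) * (n - w).choose i + r =
      n.choose w := by
    rw [← h1]; simp [valency]
  have h2' : (C.card : ℝ) * (w.choose (e + 1) * (n - w).choose (e + 1)) ≤
      T * r + {p ∈ C ×ˢ C | (p.1 \ p.2).card = 2 * e + 1}.card *
        ((2 * e + 1).choose e : ℝ) ^ 2 := by
    rw [valency] at h2; exact_mod_cast h2
  have h3 : (C.card : ℝ) * (((w.choose (e + 1) : ℝ) * ((n - w).choose (e + 1) : ℝ) -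
      ((2 * e + 1).choose e : ℝ) ^ 2 * U) / (T : ℝ)) ≤ r := by
    rw [← mul_div_assoc]
    -- The case `T = 0` is included: the quotient is then 0.
    refine div_le_of_le_mul₀ (Nat.cast_nonneg _) (Nat.cast_nonneg _) ?_
    have := mul_le_mul_of_nonneg_right hA (sq_nonneg ((2 * e + 1).choose e : ℝ))
    linarith
  rw [boundDenominator, mul_add, ← h1']
  gcongr

end JohnsonScheme

theorem mainTheorem11 (n w e : ℕ) (hwn : 2 * w ≤ n) (hew : e < w) :
    ∃ U : ℝ, IsGreatest (JohnsonScheme.lpValues n w e) U ∧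
      (constWeightA n (4 * e + 2) w : ℝ) * JohnsonScheme.boundDenominator n w e U ≤
        (n.choose w : ℝ) ∧
      (0 < JohnsonScheme.boundDenominator n w e U →
        (constWeightA n (4 * e + 2) w : ℝ) ≤
          (n.choose w : ℝ) / JohnsonScheme.boundDenominator n w e U) := by
  obtain ⟨U, hU⟩ := JohnsonScheme.exists_isGreatest_lpValues hwn e
  have h := JohnsonScheme.constWeightA_mul_boundDenominator_le hwn hU.2
  exact ⟨U, hU, h, fun hD => (le_div_iff₀ hD).2 h⟩
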